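/- Let $N\ge 2$ be an integer and use the finite alphabet $\mathcal{A}=\{a_i : i\in\mathbb{Z}/N\mathbb{Z}\}$, with indices added modulo $N$. For a substitution $\theta$ on $\mathcal{A}$, a finite word is called legal if it is a subword of $\theta^k(a)$ for some $k\ge 0$ and $a\in\mathcal{A}$, and the shift defined by $\theta$ is the set of all $x\in\mathcal{A}^{\mathbb{Z}}$ all of whose finite subwords are legal. Let $\mathbb{X}_N$ (the cyclic Thue–Morse shift) and $\mathbb{X}'_N$ be the shifts defined by $a_i\mapsto a_i a_{i+1}$ and by $a_i\mapsto a_0 a_{i+1}$, respectively. For a shift space $\mathbb{X}$ (a closed, shift-invariant subset of $\mathcal{A}^{\mathbb{Z}}$) with shift map $(Sx)_n=x_{n+1}$, let $\mathrm{Aut}(\mathbb{X})$ be the group of all homeomorphisms of $\mathbb{X}$, let $\mathcal{S}(\mathbb{X})=\{H\in\mathrm{Aut}(\mathbb{X}) : HS=SH\}$ and $\mathcal{R}(\mathbb{X})=\{H\in\mathrm{Aut}(\mathbb{X}) : HSH^{-1}=S^{\pm1}\}$. A reversor is an $H\in\mathrm{Aut}(\mathbb{X})$ with $HSH^{-1}=S^{-1}$;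 $\mathbb{X}$ is reversible if it has a reversor, and reflection invariant if $R(\mathbb{X})=\mathbb{X}$ for $(Rx)_n=x_{-n}$. An involution is an element of order exactly $2$. Let $C_m$ denote the cyclic group of order $m$; in the semidirect products below, the generator of $C_2$ acts by inversion on the abelian normal factor, and the isomorphisms can be chosen such that $\mathcal{S}$ corresponds to this normal factor. (1) $\mathcal{S}(\mathbb{X}'_N)=\langle S\rangle\simeq\mathbb{Z}$. The shift $\mathbb{X}'_N$ is reversible, with $\mathcal{R}(\mathbb{X}'_N)\simeq\mathbb{Z}\rtimes C_2$, and all reversors of $\mathbb{X}'_N$ are involutions. (2) The shift $\mathbb{X}_N$ is a global $N:1$ cover of $\mathbb{X}'_N$: the sliding block map $\varphi$ induced by $a_i a_j\mapsto a_{i+1-j}$ (applied to the letters at positions $n,n+1$ to give the letter at position $n$) is continuous, commutes with the shift, satisfies $\varphi(\mathbb{X}_N)=\mathbb{X}'_N$, and every point of $\mathbb{X}'_N$ has exactly $N$ preimages in $\mathbb{X}_N$. One has $\mathcal{S}(\mathbb{X}_N)\simeq\mathbb{Z}\times C_N$. The shift $\mathbb{X}_N$ is reflection invariant if and only if $N=2$,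 but for every $N\ge2$ it is reversible, with an involutory reversor, and $\mathcal{R}(\mathbb{X}_N)\simeq(\mathbb{Z}\times C_N)\rtimes C_2$. All reversors of $\mathbb{X}_N$ are involutions. -/

import Mathlib

/-- The (left) shift `(S x) n = x (n + 1)` on the full shift space `A ^ ℤ`. -/
def fullShift (A : Type*) [TopologicalSpace A] : (ℤ → A) ≃ₜ (ℤ → A) where
  toFun x n := x (n + 1)
  invFun x n := x (n - 1)
  left_inv x := by funext n; simp
  right_inv x := by funext n; simp
  continuous_toFun := by fun_prop
  continuous_invFun := by fun_prop

/-- A (two-sided) shift space over `A`: a closed, shift invariant subset of `A ^ ℤ`. -/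
structure Subshift (A : Type*) [TopologicalSpace A] where
  carrier : Set (ℤ → A)
  isClosed : IsClosed carrier
  shift_mem_iff : ∀ x, x ∈ carrier ↔ fullShift A x ∈ carrier

namespace Subshift

variable {A : Type*} [TopologicalSpace A]

/-- The underlying (compact, if `A` is finite) space of a shift, with the subspace topology. -/
abbrev Points (X : Subshift A) : Type _ := {x : ℤ → A // x ∈ X.carrier}

/-- The shift `S`, as an element of the group `Aut (X)` of all homeomorphisms of `X`. -/
def shift (X : Subshift A) : X.Points ≃ₜ X.Points :=
  (fullShift A).subtype X.shift_mem_iff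

/-- The symmetry group `𝒮(X)`: the centraliser of `⟨S⟩` in the group of homeomorphisms of `X`. -/
def symmetryGroup (X : Subshift A) : Subgroup (X.Points ≃ₜ X.Points) :=
  Subgroup.centralizer (Subgroup.zpowers X.shift : Set (X.Points ≃ₜ X.Points))

/-- The reversing symmetry group `ℛ(X)`: all homeomorphisms `H` of `X` such that
`H ∘ S ∘ H⁻¹` is `S` or `S⁻¹`. -/
def reversingGroup (X : Subshift A) : Subgroup (X.Points ≃ₜ X.Points) where
  carrier := {H | H * X.shift * H⁻¹ = X.shift ∨ H * X.shift * H⁻¹ = X.shift⁻¹}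
  one_mem' := by left; simp
  mul_mem' := by
    intro a b ha hb
    have key : a * b * X.shift * (a * b)⁻¹ = a * (b * X.shift * b⁻¹) * a⁻¹ := by group
    have key2 : a * X.shift⁻¹ * a⁻¹ = (a * X.shift * a⁻¹)⁻¹ := by group
    simp only [Set.mem_ofPred_eq] at ha hb ⊢
    rw [key]
    rcases hb with hb | hb <;> rw [hb]
    · exact ha
    · rw [key2]
      rcases ha with ha | ha <;> rw [ha]
      · right; rfl
      · left; simp
  inv_mem' := by
    intro a ha
    simp only [Set.mem_ofPred_eq] at ha ⊢
    rcases ha with ha | ha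
    · left
      calc a⁻¹ * X.shift * a⁻¹⁻¹ = a⁻¹ * (a * X.shift * a⁻¹) * a⁻¹⁻¹ := by rw [ha]
        _ = X.shift := by group
    · right
      calc a⁻¹ * X.shift * a⁻¹⁻¹ = a⁻¹ * (X.shift⁻¹)⁻¹ * a⁻¹⁻¹ := by rw [inv_inv X.shift]
        _ = a⁻¹ * (a * X.shift * a⁻¹)⁻¹ * a⁻¹⁻¹ := by rw [ha]
        _ = X.shift⁻¹ := by group

/-- A reversor: a homeomorphism of `X` that conjugates the shift into its inverse. -/
def IsReversor (X : Subshift A) (H : X.Points ≃ₜ X.Points) : Prop :=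
  H * X.shift * H⁻¹ = X.shift⁻¹

/-- The shift `X` is reversible if it has a reversor. -/
def IsReversible (X : Subshift A) : Prop :=
  ∃ H : X.Points ≃ₜ X.Points, X.IsReversor H

/-- Reflection invariance: `R(X) = X`, where `(R x) n = x (-n)`. -/
def IsReflectionInvariant (X : Subshift A) : Prop :=
  (fun (x : ℤ → A) (n : ℤ) => x (-n)) '' X.carrier = X.carrier

/-- `X` is a global `N : 1` cover of `Y` through `f`: the map `f` is a factor map from `X`
onto `Y` for which every point of `Y` has exactly `N` preimages in `X`. -/
structure IsGlobalCover {B : Type*} [TopologicalSpace B] (N : ℕ) (f : (ℤ → A) → (ℤ → B))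
    (X : Subshift A) (Y : Subshift B) : Prop where
  continuousOn : ContinuousOn f X.carrier
  image_eq : f '' X.carrier = Y.carrier
  equivariant : ∀ x ∈ X.carrier, f (fullShift A x) = fullShift B (f x)
  card_fibre : ∀ y ∈ Y.carrier, {x ∈ X.carrier | f x = y}.encard = N

end Subshift

/-- The action of a substitution `θ : A → List A` on finite words, by concatenation. -/
def substWord {A : Type*} (θ : A → List A) (w : List A) : List A := w.flatMap θ

/-- A finite word is legal for `θ` if it is a subword of `θ ^ k (a)` for some `k` and
some letter `a`. -/
def IsLegal {A : Type*} (θ : A → List A) (w : List A) : Prop :=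
  ∃ (k : ℕ) (a : A), w <:+: (substWord θ)^[k] [a]

/-- The shift defined by a substitution `θ`: all bi-infinite sequences all of whose finite
subwords are legal. For primitive `θ`, this is the orbit closure of any bi-infinite fixed
point, with legal seed, of any power of `θ`. -/
def substShift {A : Type*} [TopologicalSpace A] [DiscreteTopology A] (θ : A → List A) :
    Subshift A where
  carrier := {x | ∀ (m : ℤ) (l : ℕ), IsLegal θ (List.ofFn fun i : Fin l => x (m + (i : ℕ)))}
  isClosed := by
    simp only [Set.ofPred_forall]
    refine isClosed_iInter fun m => isClosed_iInter fun l => ?_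
    have hc : Continuous fun (x : ℤ → A) (i : Fin l) => x (m + (i : ℕ)) := by fun_prop
    exact (isClosed_discrete {w : Fin l → A | IsLegal θ (List.ofFn w)}).preimage hc
  shift_mem_iff := by
    intro x
    constructor
    · intro h m l
      have := h (m + 1) l
      simpa [fullShift, add_right_comm] using this
    · intro h m l
      have := h (m - 1) l
      have e : ∀ i : Fin l, m - 1 + ((i : ℕ) : ℤ) + 1 = m + ((i : ℕ) : ℤ) := fun i => by ring
      simpa [fullShift, e] using this

/-- The cyclic Thue--Morse substitution `a_i ↦ a_i a_{i+1}`, with `i` modulo `N`. -/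
def cyclicTM (N : ℕ) (i : ZMod N) : List (ZMod N) := [i, i + 1]

/-- The substitution `a_i ↦ a_0 a_{i+1}`, with `i` modulo `N`. -/
def cyclicPD (N : ℕ) (i : ZMod N) : List (ZMod N) := [0, i + 1]

/-- The cyclic Thue--Morse shift. -/
def cyclicTMShift (N : ℕ) : Subshift (ZMod N) := substShift (cyclicTM N)

/-- The shift of the substitution `a_i ↦ a_0 a_{i+1}` (period doubling shift for `N = 2`). -/
def cyclicPDShift (N : ℕ) : Subshift (ZMod N) := substShift (cyclicPD N)

/-- The sliding block map induced by `a_i a_j ↦ a_{i+1-j}`. -/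
def cyclicBlockMap (N : ℕ) (x : ℤ → ZMod N) (n : ℤ) : ZMod N := x n + 1 - x (n + 1)

/-- The action of `C₂` on an abelian group by inversion. -/
def inversionAction (G : Type*) [CommGroup G] : Multiplicative (ZMod 2) →* MulAut G where
  toFun c := if c = 1 then 1 else MulEquiv.inv G
  map_one' := by simp
  map_mul' := by
    have h : ∀ c : Multiplicative (ZMod 2), c = 1 ∨ c = Multiplicative.ofAdd 1 := by decide
    have h1 : (Multiplicative.ofAdd (1 : ZMod 2)) ≠ 1 := by decide
    have h2 : (Multiplicative.ofAdd (1 : ZMod 2)) * Multiplicative.ofAdd 1 = 1 := by decide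
    intro c d
    rcases h c with rfl | rfl <;> rcases h d with rfl | rfl
    · simp
    · simp
    · simp
    · rw [h2, if_pos rfl, if_neg h1]
      ext g
      simp

/-!
Both substitutions have the form `θ (u n) = u (2 n) u (2 n + 1)` for an explicit sequence `u`: the
binary digit sum for the cyclic Thue-Morse substitution, and `n ↦ v₂ (n + 1)` for the other one
(everything modulo `N`). So the legal words are the subwords of `u`, and membership in either shift
is a statement about windows of `u` (`mem_substShift_iff`).

Since `s (n + 1) = s n + 1 - v₂ (n + 1)` for the digit sum `s`, the block map `φ` sends the first
sequence to the second, and a sequence belongs to the cyclic Thue-Morse shift if and only if its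
image under `φ` belongs to the factor shift (`cyclicBlockMap_mem_iff`). As `φ x` determines `x` up to
an additive constant, this gives the `N : 1` cover.

A long enough window of the valuation sequence determines its position modulo a given power of `2`.
Hence two distinct points of the factor shift that agree far to the right are, up to the same
translation, both *singular points*: they agree with `v₂` away from `0` and take an arbitrary value
at `0` (`eq_val2_of_right_asymptotic`). Homeomorphisms that commute with the shift preserve right
asymptotic pairs, so, after composition with a power of the shift, they map singular points (or
their preimages under `φ`) to points of the same kind. Translating by `2 ^ k`, with `k → ∞` in a
fixed residue class modulo `N`, turns every singular point into the same limit, which shows that the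
homeomorphism is the identity (or adds a constant) at a point with dense orbit. This determines the
symmetry groups (`eq_zpow_of_mem_symmetryGroup_cyclicPDShift`, `range_symmetryTM`).

The factor shift is invariant under `y ↦ y (-n)`, and the cyclic Thue-Morse shift under
`x ↦ -x (-n)`. These are involutory reversors that invert every symmetry, and the statements on
reversing symmetries follow by group theory (`Subshift.exists_reversingGroup_equiv`).
-/

/-! ### Shifts of substitutions of length two -/

theorem flatMap_range_pair {A : Type*} (g : ℕ → A) (n : ℕ) :
    (List.range n).flatMap (fun i => [g (2 * i), g (2 * i + 1)]) = (List.range (2 * n)).map g := by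
  induction n with
  | zero => simp
  | succ n ih =>
    rw [List.range_succ, List.flatMap_append, ih, Nat.mul_succ, List.range_succ, List.range_succ]
    simp

/-- If `θ (u n) = u (2 n) u (2 n + 1)`, then `θ ^ k (u q)` is the block of `u` of length `2 ^ k`
starting at `2 ^ k * q`. -/
theorem iterate_substWord {A : Type*} {θ : A → List A} {u : ℕ → A}
    (hu : ∀ n, θ (u n) = [u (2 * n), u (2 * n + 1)]) (k q : ℕ) :
    (substWord θ)^[k] [u q] = (List.range (2 ^ k)).map fun i => u (2 ^ k * q + i) := by
  induction k with
  | zero => simp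
  | succ k ih =>
    rw [Function.iterate_succ_apply', ih, substWord, List.flatMap_map, pow_succ', ←
      flatMap_range_pair]
    congr 1
    funext i
    rw [hu]
    congr 2 <;> ring_nf

/-- If a surjective sequence `u` satisfies `θ (u n) = u (2 n) u (2 n + 1)`, then the legal words
of `θ` are the subwords of `u`. -/
theorem isLegal_ofFn_iff {A : Type*} {θ : A → List A} {u : ℕ → A}
    (hu : ∀ n, θ (u n) = [u (2 * n), u (2 * n + 1)]) (hs : Function.Surjective u)
    {l : ℕ} (w : Fin l → A) :
    IsLegal θ (List.ofFn w) ↔ ∃ p, ∀ i : Fin l, w i = u (p + i) := by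
  constructor
  · rintro ⟨k, a, h⟩
    obtain ⟨q, rfl⟩ := hs a
    rw [iterate_substWord hu, List.infix_iff_getElem?] at h
    obtain ⟨r, hr, h⟩ := h
    refine ⟨2 ^ k * q + r, fun i => ?_⟩
    have := h i (by simp)
    simp only [List.length_ofFn, List.length_map, List.length_range] at hr
    have hi : (i : ℕ) + r < 2 ^ k := by omega
    simp [List.getElem?_map, List.getElem?_range hi] at this
    rw [← this]
    congr 1
    ring
  · rintro ⟨p, h⟩
    refine ⟨p + l, u 0, ?_⟩
    rw [iterate_substWord hu, List.infix_iff_getElem?]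
    have hlt : p + l < 2 ^ (p + l) := Nat.lt_two_pow_self
    refine ⟨p, by simp; omega, fun i hi => ?_⟩
    simp only [List.length_ofFn] at hi
    have hi' : i + p < 2 ^ (p + l) := by omega
    rw [mul_zero, List.getElem?_map, List.getElem?_range hi']
    simp [h, add_comm i]

theorem mem_substShift_iff {A : Type*} [TopologicalSpace A] [DiscreteTopology A]
    {θ : A → List A} {u : ℕ → A}
    (hu : ∀ n, θ (u n) = [u (2 * n), u (2 * n + 1)]) (hs : Function.Surjective u) (x : ℤ → A) :
    x ∈ (substShift θ).carrier ↔
      ∀ L : ℕ, ∃ p : ℤ, L ≤ p ∧ ∀ n : ℤ, |n| ≤ L → x n = u (p + n).toNat := by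
  simp only [substShift, Set.mem_ofPred_eq, isLegal_ofFn_iff hu hs]
  constructor
  · intro h L
    obtain ⟨p, hp⟩ := h (-L) (2 * L + 1)
    refine ⟨p + L, by omega, fun n hn => ?_⟩
    rw [abs_le] at hn
    have := hp ⟨(n + L).toNat, by omega⟩
    simp only at this
    convert this using 2 <;> omega
  · intro h m l
    obtain ⟨p, hp, h⟩ := h (m.natAbs + l)
    refine ⟨(p + m).toNat, fun i => ?_⟩
    have hi := i.2
    rw [h (m + i) (by rw [abs_le]; omega)]
    congr 1
    omega

/-! ### The 2-adic valuation and the binary digit sum modulo `N` -/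

/-- The 2-adic valuation of an integer, modulo `N` (with value `0` at `0`). -/
def val2 (N : ℕ) (n : ℤ) : ZMod N := (padicValInt 2 n : ZMod N)

theorem padicValInt_two_pow_mul_odd (k : ℕ) {m : ℤ} (hm : Odd m) :
    padicValInt 2 (2 ^ k * m) = k := by
  have hm0 : m ≠ 0 := by rintro rfl; simp at hm
  have h2 : ∀ j : ℕ, (2 : ℤ) ^ j ∣ 2 ^ k * m ↔ j ≤ padicValInt 2 (2 ^ k * m) := fun j => by
    have := padicValInt_dvd_iff (p := 2) j (2 ^ k * m)
    simpa [hm0] using this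
  refine le_antisymm ?_ ((h2 k).1 (dvd_mul_right _ _))
  by_contra! h
  have h3 := (h2 (k + 1)).2 h
  rw [pow_succ, mul_dvd_mul_iff_left (by positivity)] at h3
  exact (Int.not_even_iff_odd.2 hm) (even_iff_two_dvd.2 h3)

theorem Int.exists_eq_two_pow_mul_odd {n : ℤ} (hn : n ≠ 0) :
    ∃ (k : ℕ) (m : ℤ), Odd m ∧ n = 2 ^ k * m := by
  obtain ⟨k, m, hm, h⟩ := Nat.exists_eq_two_pow_mul_odd (Int.natAbs_ne_zero.2 hn)
  have hm' : Odd (m : ℤ) := by exact_mod_cast hm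
  have h' : (n.natAbs : ℤ) = 2 ^ k * m := by exact_mod_cast h
  rcases Int.natAbs_eq n with h1 | h1
  · exact ⟨k, m, hm', by rw [h1, h']⟩
  · exact ⟨k, -m, hm'.neg, by rw [h1, h']; ring⟩

section Val2

variable {N : ℕ}

theorem val2_two_pow_mul_odd (k : ℕ) {m : ℤ} (hm : Odd m) : val2 N (2 ^ k * m) = k := by
  rw [val2, padicValInt_two_pow_mul_odd k hm]

theorem val2_odd {m : ℤ} (hm : Odd m) : val2 N m = 0 := by
  simpa using val2_two_pow_mul_odd (N := N) 0 hm

theorem val2_two_pow (k : ℕ) : val2 N (2 ^ k) = k := by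
  simpa using val2_two_pow_mul_odd (N := N) k odd_one

theorem val2_two_mul {n : ℤ} (hn : n ≠ 0) : val2 N (2 * n) = val2 N n + 1 := by
  obtain ⟨k, m, hm, rfl⟩ := Int.exists_eq_two_pow_mul_odd hn
  rw [← mul_assoc, ← pow_succ', val2_two_pow_mul_odd _ hm, val2_two_pow_mul_odd _ hm]
  simp

theorem val2_neg (n : ℤ) : val2 N (-n) = val2 N n := by simp [val2, padicValInt]

/-- The valuation of `a` depends only on the class of `a` modulo `2 ^ k`, unless that class
is zero. -/
theorem val2_add_of_dvd {k : ℕ} {a d : ℤ} (ha : ¬ (2 : ℤ) ^ k ∣ a) (hd : (2 : ℤ) ^ k ∣ d) :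
    val2 N (a + d) = val2 N a := by
  have ha0 : a ≠ 0 := by rintro rfl; simp at ha
  obtain ⟨v, m, hm, rfl⟩ := Int.exists_eq_two_pow_mul_odd ha0
  have hv : v < k := by
    by_contra! h
    exact ha (dvd_mul_of_dvd_left (pow_dvd_pow 2 h) m)
  obtain ⟨e, rfl⟩ := hd
  obtain ⟨j, rfl⟩ := Nat.exists_eq_add_of_lt hv
  have : (2 : ℤ) ^ v * m + 2 ^ (v + j + 1) * e = 2 ^ v * (m + 2 * (2 ^ j * e)) := by ring
  rw [this, val2_two_pow_mul_odd _ hm, val2_two_pow_mul_odd _ (hm.add_even (even_two_mul _))]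

theorem not_two_pow_dvd_of_abs_lt {k : ℕ} {a : ℤ} (h0 : a ≠ 0) (h : |a| < 2 ^ k) :
    ¬ (2 : ℤ) ^ k ∣ a := fun hd =>
  h0 (Int.eq_zero_of_abs_lt_dvd hd h)

/-- A block of length `2 ^ (K + 1)` of the sequence of valuations determines its position
modulo `2 ^ K`. -/
theorem two_pow_dvd_sub_of_val2_eq (hN : 2 ≤ N) {K : ℕ} {M p p' : ℤ}
    (h : ∀ n, M ≤ n → n < M + 2 ^ (K + 1) → val2 N (p + n) = val2 N (p' + n)) :
    (2 : ℤ) ^ K ∣ p' - p := by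
  by_contra hK
  have hd0 : p' - p ≠ 0 := fun h0 => hK (by simp [h0])
  obtain ⟨v, m, hm, hd⟩ := Int.exists_eq_two_pow_mul_odd hd0
  have hv : v < K := by
    by_contra! hv
    exact hK (hd ▸ dvd_mul_of_dvd_left (pow_dvd_pow 2 hv) m)
  -- At a position `n` where `p + n` has valuation exactly `v + 1`, `p' + n` has valuation `v`.
  set n := M + (2 ^ (v + 1) - p - M) % 2 ^ (v + 2) with hn
  have hpos : (0 : ℤ) < 2 ^ (v + 2) := by positivity
  have h1 := Int.emod_nonneg (2 ^ (v + 1) - p - M) hpos.ne'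
  have h2 := Int.emod_lt_of_pos (2 ^ (v + 1) - p - M) hpos
  have h3 : (2 : ℤ) ^ (v + 2) ≤ 2 ^ (K + 1) := pow_le_pow_right₀ (by norm_num) (by omega)
  have h4 := Int.emod_add_mul_ediv (2 ^ (v + 1) - p - M) (2 ^ (v + 2))
  set q := (2 ^ (v + 1) - p - M) / 2 ^ (v + 2)
  have e1 : p + n = 2 ^ (v + 1) * (1 + 2 * (-q)) := by
    rw [hn]; linear_combination h4
  have e2 : p' + n = 2 ^ v * (m + 2 * (1 + 2 * (-q))) := by
    have : p' + n = (p + n) + (p' - p) := by ring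
    rw [this, hd, e1]; ring
  have heq := h n (by omega) (by omega)
  rw [e1, e2, val2_two_pow_mul_odd _ (odd_one.add_even (even_two_mul _)),
    val2_two_pow_mul_odd _ (hm.add_even (even_two_mul _))] at heq
  have : Fact (1 < N) := ⟨hN⟩
  simp at heq

end Val2

/-- The sum of the binary digits of a natural number, modulo `N`. -/
def digitSum (N : ℕ) (n : ℕ) : ZMod N := ((Nat.digits 2 n).sum : ZMod N)

section DigitSum

variable {N : ℕ}

@[simp] theorem digitSum_zero : digitSum N 0 = 0 := by simp [digitSum]

theorem digitSum_two_mul (n : ℕ) : digitSum N (2 * n) = digitSum N n := by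
  rcases Nat.eq_zero_or_pos n with rfl | hn
  · simp
  · have := Nat.digits_add 2 (by norm_num) 0 n (by norm_num) (Or.inr hn.ne')
    rw [zero_add] at this
    simp [digitSum, this]

theorem digitSum_two_mul_add_one (n : ℕ) : digitSum N (2 * n + 1) = digitSum N n + 1 := by
  have := Nat.digits_add 2 (by norm_num) 1 n (by norm_num) (Or.inl one_ne_zero)
  rw [add_comm 1] at this
  rw [digitSum, this]
  simp [digitSum, add_comm]

theorem digitSum_succ (n : ℕ) :
    digitSum N (n + 1) = digitSum N n + 1 - val2 N ((n : ℤ) + 1) := by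
  induction n using Nat.strong_induction_on with
  | _ n ih =>
    obtain ⟨m, rfl | rfl⟩ := Nat.even_or_odd' n
    · rw [digitSum_two_mul, digitSum_two_mul_add_one, val2_odd ⟨m, by push_cast; ring⟩, sub_zero]
    · have h1 : ((2 * m + 1 : ℕ) : ℤ) + 1 = 2 * ((m : ℤ) + 1) := by push_cast; ring
      rw [h1, val2_two_mul (by omega), show 2 * m + 1 + 1 = 2 * (m + 1) by ring,
        digitSum_two_mul, digitSum_two_mul_add_one, ih m (by omega)]
      ring

theorem digitSum_add_two_pow {k n : ℕ} (hn : n < 2 ^ k) :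
    digitSum N (n + 2 ^ k) = digitSum N n + 1 := by
  induction k generalizing n with
  | zero =>
    obtain rfl : n = 0 := by omega
    simpa using digitSum_two_mul_add_one (N := N) 0
  | succ k ih =>
    rw [pow_succ'] at hn ⊢
    obtain ⟨m, rfl | rfl⟩ := Nat.even_or_odd' n
    · rw [← mul_add, digitSum_two_mul, digitSum_two_mul, ih (by omega)]
    · rw [show 2 * m + 1 + 2 * 2 ^ k = 2 * (m + 2 ^ k) + 1 by ring, digitSum_two_mul_add_one,
        digitSum_two_mul_add_one, ih (by omega)]

/-- Adding a suitable number `M`, whose binary digits lie beyond those of all `n < B`, adds a given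
constant to the digit sums of these `n`. -/
theorem exists_digitSum_add_eq [NeZero N] (t : ZMod N) (B : ℕ) :
    ∃ M : ℕ, ∀ n < B, digitSum N (n + M) = digitSum N n + t := by
  obtain ⟨t, rfl⟩ := ZMod.natCast_zmod_surjective t
  induction t with
  | zero => exact ⟨0, by simp⟩
  | succ t ih =>
    obtain ⟨M, hM⟩ := ih
    refine ⟨M + 2 ^ (B + M), fun n hn => ?_⟩
    have : B + M < 2 ^ (B + M) := Nat.lt_two_pow_self
    rw [← add_assoc, digitSum_add_two_pow (by omega), hM n hn]
    push_cast
    ring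

theorem digitSum_surjective [NeZero N] : Function.Surjective (digitSum N) := fun t => by
  obtain ⟨M, hM⟩ := exists_digitSum_add_eq t 1
  exact ⟨0 + M, by simpa using hM 0 one_pos⟩

theorem val2_succ_surjective [NeZero N] :
    Function.Surjective fun n : ℕ => val2 N ((n : ℤ) + 1) := fun t => by
  obtain ⟨t, rfl⟩ := ZMod.natCast_zmod_surjective t
  refine ⟨2 ^ t - 1, ?_⟩
  have : 1 ≤ 2 ^ t := Nat.one_le_two_pow
  simp [this, val2_two_pow]

/-! ### Description of the two shifts by windows -/

theorem mem_cyclicPDShift_iff [NeZero N] (y : ℤ → ZMod N) :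
    y ∈ (cyclicPDShift N).carrier ↔
      ∀ L : ℕ, ∃ p : ℤ, L < p ∧ ∀ n : ℤ, |n| ≤ L → y n = val2 N (p + n) := by
  have hu : ∀ n : ℕ, cyclicPD N (val2 N ((n : ℤ) + 1)) =
      [val2 N (((2 * n : ℕ) : ℤ) + 1), val2 N (((2 * n + 1 : ℕ) : ℤ) + 1)] := fun n => by
    rw [cyclicPD, val2_odd (m := ((2 * n : ℕ) : ℤ) + 1) ⟨n, by push_cast; ring⟩,
      ← val2_two_mul (by omega)]
    push_cast
    ring_nf
  rw [cyclicPDShift, mem_substShift_iff (u := fun n : ℕ => val2 N ((n : ℤ) + 1)) hu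
    val2_succ_surjective]
  refine forall_congr' fun L => ⟨?_, ?_⟩
  · rintro ⟨p, hp, h⟩
    refine ⟨p + 1, by omega, fun n hn => ?_⟩
    have := abs_le.1 hn
    rw [h n hn]
    congr 1
    omega
  · rintro ⟨p, hp, h⟩
    refine ⟨p - 1, by omega, fun n hn => ?_⟩
    have := abs_le.1 hn
    rw [h n hn]
    congr 1
    omega

theorem mem_cyclicTMShift_iff [NeZero N] (x : ℤ → ZMod N) :
    x ∈ (cyclicTMShift N).carrier ↔
      ∀ L : ℕ, ∃ p : ℤ, L ≤ p ∧ ∀ n : ℤ, |n| ≤ L → x n = digitSum N (p + n).toNat :=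
  mem_substShift_iff (θ := cyclicTM N)
    (fun n => by rw [cyclicTM, digitSum_two_mul, digitSum_two_mul_add_one]) digitSum_surjective x

end DigitSum

/-! ### The block map -/

section BlockMap

variable {N : ℕ}

theorem eq_of_succ_eq {A : Type*} {d : ℤ → A} {a b : ℤ}
    (h : ∀ n, a ≤ n → n < b → d (n + 1) = d n) {m n : ℤ} (ham : a ≤ m) (hmb : m ≤ b)
    (han : a ≤ n) (hnb : n ≤ b) : d m = d n := by
  have key : ∀ n, a ≤ n → n ≤ b → d n = d a := by
    intro n hn
    induction n, hn using Int.leInduction with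
    | base => intro _; rfl
    | succ n hn ih => intro hb; rw [h n hn (by omega), ih (by omega)]
  rw [key m ham hmb, key n han hnb]

/-- On an interval, a sequence is determined by its image under the block map and by its value
at one position. -/
theorem eq_of_cyclicBlockMap_eq {x x' : ℤ → ZMod N} {a b k : ℤ}
    (h : ∀ n, a ≤ n → n < b → cyclicBlockMap N x n = cyclicBlockMap N x' n)
    (hak : a ≤ k) (hkb : k ≤ b) (hk : x k = x' k) {n : ℤ} (han : a ≤ n) (hnb : n ≤ b) :
    x n = x' n := by
  have := eq_of_succ_eq (d := fun n => x n - x' n) (a := a) (b := b) (fun n h1 h2 => by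
    have := h n h1 h2
    simp only [cyclicBlockMap] at this
    linear_combination -this) hak hkb han hnb
  simp only [hk, sub_self] at this
  exact (sub_eq_zero.1 this.symm)

theorem exists_cyclicBlockMap_eq (y : ℤ → ZMod N) (k : ℤ) (a : ZMod N) :
    ∃ x, cyclicBlockMap N x = y ∧ x k = a := by
  -- A primitive of `1 - y`.
  let f : ℤ → ZMod N := fun n =>
    ∑ i ∈ Finset.Ico 0 n, (1 - y i) - ∑ i ∈ Finset.Ico n 0, (1 - y i)
  have hf : ∀ n, f (n + 1) = f n + (1 - y n) := by
    intro n
    rcases le_or_gt 0 n with hn | hn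
    · have e : Finset.Ico 0 (n + 1) = insert n (Finset.Ico 0 n) := by ext; simp; omega
      simp only [f, e]
      rw [Finset.sum_insert (by simp), Finset.Ico_eq_empty (a := n) (by omega),
        Finset.Ico_eq_empty (a := n + 1) (by omega)]
      simp; ring
    · have e : Finset.Ico n 0 = insert n (Finset.Ico (n + 1) 0) := by ext; simp; omega
      simp only [f, e]
      rw [Finset.sum_insert (by simp), Finset.Ico_eq_empty (b := n) (by omega),
        Finset.Ico_eq_empty (b := n + 1) (by omega)]
      simp; ring
  refine ⟨fun n => f n + (a - f k), ?_, by simp⟩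
  funext n
  simp only [cyclicBlockMap, hf]
  ring

theorem cyclicBlockMap_add_const (x : ℤ → ZMod N) (t : ZMod N) :
    cyclicBlockMap N (fun n => x n + t) = cyclicBlockMap N x := by
  funext n; simp only [cyclicBlockMap]; ring

theorem cyclicBlockMap_neg_reflect (x : ℤ → ZMod N) :
    cyclicBlockMap N (fun n => -x (-n)) = fun n => cyclicBlockMap N x (-(n + 1)) := by
  funext n
  simp only [cyclicBlockMap, show -(n + 1) + 1 = -n by ring]
  ring

/-- The cyclic Thue-Morse shift is the full preimage of the factor shift under the block map. -/
theorem cyclicBlockMap_mem_iff [NeZero N] (x : ℤ → ZMod N) :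
    cyclicBlockMap N x ∈ (cyclicPDShift N).carrier ↔ x ∈ (cyclicTMShift N).carrier := by
  rw [mem_cyclicPDShift_iff, mem_cyclicTMShift_iff]
  constructor
  · intro h L
    obtain ⟨p, hp, h⟩ := h L
    have hT := fun {m n : ℤ} => eq_of_succ_eq (m := m) (n := n)
      (d := fun n => x n - digitSum N (p - 1 + n).toNat) (a := -L) (b := L)
      fun n h1 h2 => by
        have := h n (abs_le.2 ⟨h1, h2.le⟩)
        have e : (p - 1 + (n + 1)).toNat = (p - 1 + n).toNat + 1 := by omega
        rw [cyclicBlockMap] at this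
        have e' : (((p - 1 + n).toNat : ℕ) : ℤ) + 1 = p + n := by omega
        simp only [e, digitSum_succ, e']
        linear_combination -this
    -- On the window, `x` is a digit sum window plus a constant; moving the window absorbs the
    -- constant.
    obtain ⟨M, hM⟩ := exists_digitSum_add_eq (N := N) (x 0 - digitSum N (p - 1 + 0).toNat)
      (p + L).toNat
    refine ⟨p - 1 + M, by omega, fun n hn => ?_⟩
    rw [abs_le] at hn
    have h1 := hT (m := n) (n := 0) (by omega) (by omega) (by omega) (by omega)
    have e : (p - 1 + M + n).toNat = (p - 1 + n).toNat + M := by omega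
    rw [e, hM _ (by omega)]
    linear_combination h1
  · intro h L
    obtain ⟨p, hp, h⟩ := h (L + 1)
    refine ⟨p + 1, by omega, fun n hn => ?_⟩
    rw [abs_le] at hn
    rw [cyclicBlockMap, h n (by rw [abs_le]; omega), h (n + 1) (by rw [abs_le]; omega)]
    have e : (p + (n + 1)).toNat = (p + n).toNat + 1 := by omega
    rw [e, digitSum_succ]
    have e' : (((p + n).toNat : ℕ) : ℤ) + 1 = p + 1 + n := by omega
    rw [e']
    ring

theorem mem_cyclicPDShift_of_shift (y : ℤ → ZMod N) (m : ℤ) (h : y ∈ (cyclicPDShift N).carrier) :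
    (fun n => y (n + m)) ∈ (cyclicPDShift N).carrier := by
  intro m' l
  have := h (m' + m) l
  simpa only [add_right_comm m' m] using this

theorem reflect_mem_cyclicPDShift [NeZero N] {y : ℤ → ZMod N} (h : y ∈ (cyclicPDShift N).carrier) :
    (fun n => y (-n)) ∈ (cyclicPDShift N).carrier := by
  rw [mem_cyclicPDShift_iff] at h ⊢
  intro L
  obtain ⟨p, hp, h⟩ := h L
  obtain ⟨k, hk⟩ : ∃ k : ℕ, p + L < 2 ^ k := ⟨(p + L).toNat, by
    have : (p + L).toNat < 2 ^ (p + L).toNat := Nat.lt_two_pow_self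
    zify at this
    omega⟩
  refine ⟨2 ^ k - p, by omega, fun n hn => ?_⟩
  have hn' := abs_le.1 hn
  rw [h (-n) (by simpa using hn), show (2 : ℤ) ^ k - p + n = -(p + -n) + 2 ^ k by ring,
    val2_add_of_dvd _ (dvd_refl _), val2_neg]
  exact not_two_pow_dvd_of_abs_lt (by omega) (by rw [abs_lt]; omega)

theorem neg_reflect_mem_cyclicTMShift [NeZero N] {x : ℤ → ZMod N}
    (h : x ∈ (cyclicTMShift N).carrier) :
    (fun n => -x (-n)) ∈ (cyclicTMShift N).carrier := by
  rw [← cyclicBlockMap_mem_iff] at h ⊢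
  rw [cyclicBlockMap_neg_reflect]
  exact mem_cyclicPDShift_of_shift _ 1 (reflect_mem_cyclicPDShift h)

theorem add_const_mem_cyclicTMShift [NeZero N] {x : ℤ → ZMod N}
    (h : x ∈ (cyclicTMShift N).carrier)
    (t : ZMod N) : (fun n => x n + t) ∈ (cyclicTMShift N).carrier := by
  rwa [← cyclicBlockMap_mem_iff, cyclicBlockMap_add_const, cyclicBlockMap_mem_iff]

theorem isGlobalCover_cyclicBlockMap [NeZero N] :
    Subshift.IsGlobalCover N (cyclicBlockMap N) (cyclicTMShift N) (cyclicPDShift N) where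
  continuousOn := by
    refine Continuous.continuousOn ?_
    unfold cyclicBlockMap
    fun_prop
  image_eq := by
    ext y
    constructor
    · rintro ⟨x, hx, rfl⟩
      exact (cyclicBlockMap_mem_iff x).2 hx
    · intro hy
      obtain ⟨x, rfl, -⟩ := exists_cyclicBlockMap_eq y 0 0
      exact ⟨x, (cyclicBlockMap_mem_iff x).1 hy, rfl⟩
  equivariant x _ := rfl
  card_fibre y hy := by
    obtain ⟨x, rfl, -⟩ := exists_cyclicBlockMap_eq y 0 0
    rw [cyclicBlockMap_mem_iff] at hy
    have : {z ∈ (cyclicTMShift N).carrier | cyclicBlockMap N z = cyclicBlockMap N x} =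
        (fun (t : ZMod N) n => x n + t) '' Set.univ := by
      ext z
      simp only [Set.mem_ofPred_eq, Set.mem_image, Set.mem_univ, true_and]
      constructor
      · rintro ⟨-, hz⟩
        refine ⟨z 0 - x 0, funext fun n => ?_⟩
        refine eq_of_cyclicBlockMap_eq (x := fun n => x n + (z 0 - x 0)) (x' := z)
          (a := min 0 n) (b := max 0 n) (k := 0) (fun m _ _ => ?_) (by simp) (by simp)
          (by simp) (by simp) (by simp)
        rw [cyclicBlockMap_add_const, hz]
      · rintro ⟨t, rfl⟩
        exact ⟨add_const_mem_cyclicTMShift hy t, cyclicBlockMap_add_const x t⟩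
    rw [this, Function.Injective.encard_image, Set.encard_univ, ENat.card_eq_coe_fintype_card,
      ZMod.card]
    intro s t hst
    simpa using congrFun hst 0

/-! ### Singular points and asymptotic pairs -/

/-- The points of the factor shift that agree with the valuation sequence away from `0`. -/
def singularPoint (N : ℕ) (c : ZMod N) (n : ℤ) : ZMod N := if n = 0 then c else val2 N n

/-- Near `0`, the valuation sequence translated by `2 ^ k` is a singular point with value `k` at `0`.
So these translates converge as `k → ∞` in a fixed residue class modulo `N`. -/
theorem val2_add_two_pow {n : ℤ} {k : ℕ} (hn : |n| < 2 ^ k) :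
    val2 N (n + 2 ^ k) = singularPoint N k n := by
  rw [singularPoint]
  split_ifs with h0
  · rw [h0, zero_add, val2_two_pow]
  · exact val2_add_of_dvd (not_two_pow_dvd_of_abs_lt h0 hn) (dvd_refl _)

theorem singularPoint_add_two_pow {c : ZMod N} {n : ℤ} {k : ℕ} (hn : |n| < 2 ^ k) :
    singularPoint N c (n + 2 ^ k) = singularPoint N k n := by
  rw [← val2_add_two_pow hn, singularPoint, if_neg]
  rw [abs_lt] at hn
  omega

theorem exists_two_pow_gt_natCast_eq [NeZero N] (j : ZMod N) (L : ℕ) :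
    ∃ k : ℕ, (k : ZMod N) = j ∧ L < 2 ^ k := by
  have hN := NeZero.pos N
  refine ⟨j.val + N * L, by simp, ?_⟩
  calc L < 2 ^ L := Nat.lt_two_pow_self
    _ ≤ 2 ^ (j.val + N * L) := Nat.pow_le_pow_right (by norm_num) (by nlinarith)

theorem singularPoint_mem [NeZero N] (c : ZMod N) :
    singularPoint N c ∈ (cyclicPDShift N).carrier := by
  rw [mem_cyclicPDShift_iff]
  intro L
  obtain ⟨k, rfl, hk⟩ := exists_two_pow_gt_natCast_eq c L
  zify at hk
  refine ⟨2 ^ k, hk, fun n hn => ?_⟩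
  rw [add_comm, val2_add_two_pow (hn.trans_lt hk)]

/-- If two points of the factor shift agree far to the right but differ at `n₀`, then both are
singular points with singularity at `n₀`. -/
theorem eq_val2_of_right_asymptotic [NeZero N] (hN : 2 ≤ N) {y y' : ℤ → ZMod N}
    (hy : y ∈ (cyclicPDShift N).carrier) (hy' : y' ∈ (cyclicPDShift N).carrier) {M n₀ : ℤ}
    (hM : ∀ n, M ≤ n → y n = y' n) (hne : y n₀ ≠ y' n₀) {n : ℤ} (hn : n ≠ n₀) :
    y n = val2 N (n - n₀) := by
  rw [mem_cyclicPDShift_iff] at hy hy'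
  obtain ⟨K, hK⟩ : ∃ K : ℕ, |n - n₀| < 2 ^ K := ⟨(n - n₀).natAbs, by
    have : (n - n₀).natAbs < 2 ^ (n - n₀).natAbs := Nat.lt_two_pow_self
    zify at this
    exact this⟩
  set L : ℕ := M.natAbs + 2 ^ (K + 1) + n₀.natAbs + n.natAbs with hL
  have hpow : ((2 ^ (K + 1) : ℕ) : ℤ) = 2 ^ (K + 1) := by push_cast; rfl
  obtain ⟨p, -, hp⟩ := hy L
  obtain ⟨p', -, hp'⟩ := hy' L
  have hd : (2 : ℤ) ^ K ∣ p' - p := two_pow_dvd_sub_of_val2_eq (N := N) (M := M) hN fun m h1 h2 => by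
    have : |m| ≤ L := by rw [abs_le]; omega
    rw [← hp m this, ← hp' m this, hM m h1]
  -- The common position of the windows modulo `2 ^ K` forces equality at `n₀`, unless it vanishes.
  have h0 : (2 : ℤ) ^ K ∣ p + n₀ := by
    by_contra h0
    have hn0 : |n₀| ≤ L := by rw [abs_le]; omega
    apply hne
    rw [hp _ hn0, hp' _ hn0, show p' + n₀ = p + n₀ + (p' - p) by ring, val2_add_of_dvd h0 hd]
  rw [hp n (by rw [abs_le]; omega), show p + n = n - n₀ + (p + n₀) by ring,
    val2_add_of_dvd (not_two_pow_dvd_of_abs_lt (sub_ne_zero.2 hn) hK) h0]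

/-- On the right half-line, a preimage of a singular point is a digit sum sequence. -/
theorem eq_add_digitSum {x : ℤ → ZMod N} {c : ZMod N} (h : cyclicBlockMap N x = singularPoint N c)
    (n : ℕ) : x (1 + n) = x 1 + digitSum N n := by
  induction n with
  | zero => simp
  | succ n ih =>
    have := congrFun h (1 + n)
    rw [singularPoint, if_neg (by omega), cyclicBlockMap, ih] at this
    rw [digitSum_succ]
    push_cast
    rw [← add_assoc, add_comm (n : ℤ) 1]
    linear_combination -this

/-- Translation by `2 ^ k` moves a preimage of any singular point close to a preimage of the
singular point with value `k` at `0`. -/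
theorem apply_add_two_pow_of_singular {x w : ℤ → ZMod N} {c : ZMod N} {k : ℕ}
    (hx : cyclicBlockMap N x = singularPoint N c) (hw : cyclicBlockMap N w = singularPoint N k)
    (h1 : w 1 = x 1 + 1) {n : ℤ} (hn : |n| < 2 ^ k) : x (n + 2 ^ k) = w n := by
  have hpos : (0 : ℤ) < 2 ^ k := by positivity
  rw [abs_lt] at hn
  refine eq_of_cyclicBlockMap_eq (x := fun n => x (n + 2 ^ k)) (a := -2 ^ k + 1) (b := 2 ^ k)
    (k := 1) (fun m hm hm' => ?_) (by omega) (by omega) ?_ (by omega) (by omega)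
  · have hb : cyclicBlockMap N (fun n => x (n + 2 ^ k)) m = cyclicBlockMap N x (m + 2 ^ k) := by
      simp only [cyclicBlockMap, add_right_comm]
    rw [hb, hx, hw]
    exact singularPoint_add_two_pow (by rw [abs_lt]; omega)
  · have := eq_add_digitSum hx (2 ^ k)
    have h2 := digitSum_add_two_pow (N := N) (k := k) (n := 0) (by positivity)
    rw [zero_add] at h2
    push_cast at this
    rw [h1, this, h2, digitSum_zero, zero_add]

end BlockMap

/-! ### Homeomorphisms commuting with the shift -/

namespace Subshift

section Dynamics

open Filter Topology

variable {A : Type*} [TopologicalSpace A] {X : Subshift A}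

theorem zpow_shift_apply (m : ℤ) (x : X.Points) (n : ℤ) : ((X.shift ^ m) x).1 n = x.1 (n + m) := by
  have h1 : ∀ (x : X.Points) (n : ℤ), (X.shift x).1 n = x.1 (n + 1) := fun _ _ => rfl
  induction m generalizing x n with
  | zero => simp
  | succ m ih => rw [zpow_add_one, Homeomorph.mul_apply, ih, h1, add_assoc]
  | pred m ih =>
    have h2 : (X.shift⁻¹ x).1 (n + -m) = x.1 (n + -m - 1) := rfl
    rw [zpow_sub_one, Homeomorph.mul_apply, ih, h2, add_sub_assoc]

theorem continuous_eval (n : ℤ) : Continuous fun x : X.Points => x.1 n :=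
  (continuous_apply n).comp continuous_subtype_val

theorem mem_symmetryGroup_iff {H : X.Points ≃ₜ X.Points} :
    H ∈ X.symmetryGroup ↔ Commute H X.shift := by
  rw [symmetryGroup, Subgroup.mem_centralizer_iff]
  constructor
  · intro h
    exact (h X.shift (Subgroup.mem_zpowers _)).symm
  · rintro h _ ⟨m, rfl⟩
    exact (h.zpow_right m).symm.eq

theorem apply_zpow_shift {H : X.Points ≃ₜ X.Points} (hH : H ∈ X.symmetryGroup) (m : ℤ)
    (x : X.Points) : H ((X.shift ^ m) x) = (X.shift ^ m) (H x) := by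
  have := ((mem_symmetryGroup_iff.1 hH).zpow_right m).eq
  exact congrArg (fun F : X.Points ≃ₜ X.Points => F x) this

variable [DiscreteTopology A]

theorem tendsto_points_iff {ι : Type*} {l : Filter ι} {f : ι → X.Points} {x : X.Points} :
    Tendsto f l (𝓝 x) ↔ ∀ n, ∀ᶠ i in l, (f i).1 n = x.1 n := by
  simp [tendsto_subtype_rng, tendsto_pi_nhds, nhds_discrete]

theorem tendsto_points_of_agree {f : ℕ → X.Points} {x : X.Points}
    (h : ∀ (L : ℕ) (n : ℤ), |n| ≤ L → (f L).1 n = x.1 n) : Tendsto f atTop (𝓝 x) :=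
  tendsto_points_iff.2 fun n => by
    filter_upwards [eventually_ge_atTop n.natAbs] with L hL
    exact h L n (by rw [abs_le]; omega)

/-- Two symmetries of a shift agree if they do so at one point with dense orbit. -/
theorem eq_of_apply_eq {F G : X.Points ≃ₜ X.Points} (hF : F ∈ X.symmetryGroup)
    (hG : G ∈ X.symmetryGroup) {w : X.Points} (h : F w = G w)
    (hw : ∀ (x : X.Points) (L : ℕ), ∃ m : ℤ, ∀ n : ℤ, |n| ≤ L → w.1 (n + m) = x.1 n) :
    F = G := by
  ext1 x
  choose m hm using hw x
  have ht : Tendsto (fun L => (X.shift ^ m L) w) atTop (𝓝 x) :=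
    tendsto_points_of_agree fun L n hn => by rw [zpow_shift_apply, hm L n hn]
  refine tendsto_nhds_unique ((F.continuous.tendsto x).comp ht) ?_
  have hFG : F ∘ (fun L => (X.shift ^ m L) w) = G ∘ (fun L => (X.shift ^ m L) w) := by
    funext L
    simp only [Function.comp, apply_zpow_shift hF, apply_zpow_shift hG, h]
  rw [hFG]
  exact (G.continuous.tendsto x).comp ht

/-- The image of a limit of translates of `x` under a symmetry `H` is the limit of the
corresponding translates of `H x`. -/
theorem apply_eq_of_agree {H : X.Points ≃ₜ X.Points} (hH : H ∈ X.symmetryGroup)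
    {x x' w w' : X.Points} (hx : H x = x')
    (h : ∀ L : ℕ, ∃ m : ℤ, ∀ n : ℤ, |n| ≤ L →
      x.1 (n + m) = w.1 n ∧ x'.1 (n + m) = w'.1 n) : H w = w' := by
  choose m hm using h
  have h1 : Tendsto (fun L => (X.shift ^ m L) x) atTop (𝓝 w) :=
    tendsto_points_of_agree fun L n hn => by rw [zpow_shift_apply, (hm L n hn).1]
  have h2 : Tendsto (fun L => (X.shift ^ m L) x') atTop (𝓝 w') :=
    tendsto_points_of_agree fun L n hn => by rw [zpow_shift_apply, (hm L n hn).2]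
  refine tendsto_nhds_unique ((H.continuous.tendsto w).comp h1) ?_
  convert h2 using 2
  simp only [Function.comp, apply_zpow_shift hH, hx]

variable [Finite A]

instance : CompactSpace X.Points := isCompact_iff_compactSpace.1 X.isClosed.isCompact

/-- A continuous self-map of a shift over a finite alphabet is given at `0` by a local rule. -/
theorem exists_window (H : X.Points ≃ₜ X.Points) :
    ∃ L : ℕ, ∀ x x' : X.Points, (∀ n : ℤ, |n| ≤ L → x.1 n = x'.1 n) →
      (H x).1 0 = (H x').1 0 := by
  -- Counterexamples for `L → ∞` have subsequences with a common limit.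
  by_contra! hcon
  choose x x' hxx hne using hcon
  obtain ⟨a, φ, hφ, ha⟩ := CompactSpace.tendsto_subseq x
  have ha' : Tendsto (x' ∘ φ) atTop (𝓝 a) := by
    rw [tendsto_points_iff] at ha ⊢
    intro n
    filter_upwards [ha n, eventually_ge_atTop n.natAbs] with k hk hn
    have := hφ.id_le k
    simp only [id] at this
    rw [← hk]
    exact (hxx (φ k) n (by rw [abs_le]; omega)).symm
  have h1 := tendsto_points_iff.1 ((H.continuous.tendsto a).comp ha) 0
  have h2 := tendsto_points_iff.1 ((H.continuous.tendsto a).comp ha') 0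
  obtain ⟨k, hk1, hk2⟩ := (h1.and h2).exists
  exact hne (φ k) (hk1.trans hk2.symm)

/-- Symmetries preserve right asymptotic pairs. -/
theorem right_asymptotic_apply {H : X.Points ≃ₜ X.Points} (hH : H ∈ X.symmetryGroup)
    {x x' : X.Points} {M : ℤ} (h : ∀ n, M ≤ n → x.1 n = x'.1 n) :
    ∃ M', ∀ n, M' ≤ n → (H x).1 n = (H x').1 n := by
  obtain ⟨L, hL⟩ := exists_window H
  refine ⟨M + L, fun n hn => ?_⟩
  have := hL ((X.shift ^ n) x) ((X.shift ^ n) x') fun k hk => by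
    rw [abs_le] at hk
    rw [zpow_shift_apply, zpow_shift_apply, h _ (by omega)]
  simpa only [apply_zpow_shift hH, zpow_shift_apply, zero_add] using this

end Dynamics

/-! ### Reversing symmetry groups as semidirect products -/

section Reversing

variable {A : Type*} [TopologicalSpace A] {X : Subshift A} {B : Type*} [CommGroup B]
  {f : B →* (X.Points ≃ₜ X.Points)} {r : X.Points ≃ₜ X.Points}

theorem IsReversor.notMem_symmetryGroup (hs : X.shift * X.shift ≠ 1) {H : X.Points ≃ₜ X.Points}
    (hH : X.IsReversor H) : H ∉ X.symmetryGroup := fun h => hs <| by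
  rw [mem_symmetryGroup_iff] at h
  rw [IsReversor, h.eq, mul_inv_cancel_right] at hH
  nth_rewrite 1 [hH]
  exact inv_mul_cancel _

/-- Every reversor is the product of a symmetry with a fixed reversor. -/
theorem IsReversor.exists_eq (hf : f.range = X.symmetryGroup) (hr : X.IsReversor r)
    (hr2 : r * r = 1) {H : X.Points ≃ₜ X.Points} (hH : X.IsReversor H) : ∃ b, H = f b * r := by
  have hri : r⁻¹ = r := inv_eq_of_mul_eq_one_left hr2
  have : H * r ∈ X.symmetryGroup := by
    rw [mem_symmetryGroup_iff, commute_iff_eq, ← mul_inv_eq_iff_eq_mul]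
    calc H * r * X.shift * (H * r)⁻¹ = H * (r * X.shift * r⁻¹) * H⁻¹ := by group
      _ = (H * X.shift * H⁻¹)⁻¹ := by rw [hr]; group
      _ = X.shift := by rw [hH, inv_inv]
  rw [← hf] at this
  obtain ⟨b, hb⟩ := this
  exact ⟨b, by rw [hb, mul_assoc, hr2, mul_one]⟩

theorem IsReversor.orderOf_eq_two (hs : X.shift * X.shift ≠ 1) (hf : f.range = X.symmetryGroup)
    (hr : X.IsReversor r) (hr2 : r * r = 1) (hinv : ∀ b, r * f b = f b⁻¹ * r)
    {H : X.Points ≃ₜ X.Points} (hH : X.IsReversor H) : orderOf H = 2 := by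
  refine orderOf_eq_prime ?_ fun h1 => hH.notMem_symmetryGroup hs (h1 ▸ one_mem _)
  obtain ⟨b, rfl⟩ := hr.exists_eq hf hr2 hH
  rw [pow_two, mul_assoc, ← mul_assoc r, hinv, mul_assoc, hr2, mul_one, ← map_mul,
    mul_inv_cancel, map_one]

/-- If an involutory reversor inverts every element of the abelian symmetry group, then the
reversing symmetry group is the semidirect product with `C₂` acting by inversion. -/
theorem exists_reversingGroup_equiv (hs : X.shift * X.shift ≠ 1) (hinj : Function.Injective f)
    (hf : f.range = X.symmetryGroup) (hr : X.IsReversor r) (hr2 : r * r = 1)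
    (hinv : ∀ b, r * f b = f b⁻¹ * r) :
    ∃ e : X.reversingGroup ≃* B ⋊[inversionAction B] Multiplicative (ZMod 2),
      ∀ H : X.reversingGroup, (H : X.Points ≃ₜ X.Points) ∈ X.symmetryGroup ↔
        (e H).right = 1 := by
  have hc : ∀ c : Multiplicative (ZMod 2), c = 1 ∨ c = Multiplicative.ofAdd 1 := by decide
  have hc1 : (Multiplicative.ofAdd (1 : ZMod 2)) ≠ 1 := by decide
  have hc2 : (Multiplicative.ofAdd (1 : ZMod 2)) * Multiplicative.ofAdd 1 = 1 := by decide
  have hfs : ∀ b, f b ∈ X.symmetryGroup := fun b => hf ▸ ⟨b, rfl⟩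
  have hfr : ∀ b, f b * r ∉ X.symmetryGroup := fun b h =>
    hr.notMem_symmetryGroup hs ((X.symmetryGroup.mul_mem_cancel_left (hfs b)).1 h)
  let g : Multiplicative (ZMod 2) →* (X.Points ≃ₜ X.Points) :=
    { toFun := fun c => if c = 1 then 1 else r
      map_one' := if_pos rfl
      map_mul' := fun c d => by
        rcases hc c with rfl | rfl <;> rcases hc d with rfl | rfl <;> simp [hc1, hc2, hr2] }
  have hgr : g (Multiplicative.ofAdd 1) = r := by simp [g, hc1]
  let Φ : B ⋊[inversionAction B] Multiplicative (ZMod 2) →* (X.Points ≃ₜ X.Points) :=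
    SemidirectProduct.lift f g fun c => by
      ext1 b
      rcases hc c with rfl | rfl
      · simp
      · have : inversionAction B (Multiplicative.ofAdd 1) b = b⁻¹ := by
          simp [inversionAction, hc1]
        simp only [MonoidHom.comp_apply, MulEquiv.coe_toMonoidHom, this, hgr, MulAut.conj_apply,
          hinv, mul_inv_cancel_right]
  have hΦ : ∀ b c, Φ ⟨b, c⟩ = f b * g c := fun b c => by
    rw [← SemidirectProduct.inl_left_mul_inr_right (⟨b, c⟩ : B ⋊[inversionAction B] _)]
    simp [Φ]
  have hΦs : ∀ b c, Φ ⟨b, c⟩ ∈ X.symmetryGroup ↔ c = 1 := fun b c => by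
    rcases hc c with rfl | rfl
    · simp [hΦ, hfs]
    · simp [hΦ, hgr, hfr, hc1]
  have hΦi : Function.Injective Φ := by
    rw [injective_iff_map_eq_one]
    rintro ⟨b, c⟩ h
    obtain rfl : c = 1 := (hΦs b c).1 (h ▸ one_mem _)
    rw [hΦ, map_one, mul_one] at h
    rw [hinj (h.trans (map_one f).symm)]
    rfl
  have hΦr : Φ.range = X.reversingGroup := by
    have hleft : ∀ H : X.Points ≃ₜ X.Points,
        H * X.shift * H⁻¹ = X.shift ↔ H ∈ X.symmetryGroup := fun H => by
      rw [mem_symmetryGroup_iff, commute_iff_eq, mul_inv_eq_iff_eq_mul]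
    have hsub : ∀ b, f b ∈ X.reversingGroup := fun b => Or.inl ((hleft _).2 (hfs b))
    ext H
    constructor
    · rintro ⟨⟨b, c⟩, rfl⟩
      rw [hΦ]
      rcases hc c with rfl | rfl
      · simpa using hsub b
      · rw [hgr]
        exact mul_mem (hsub b) (Or.inr hr)
    · rintro (h | h)
      · rw [hleft, ← hf] at h
        obtain ⟨b, rfl⟩ := h
        exact ⟨⟨b, 1⟩, by simp [hΦ]⟩
      · obtain ⟨b, rfl⟩ := IsReversor.exists_eq hf hr hr2 h
        exact ⟨⟨b, Multiplicative.ofAdd 1⟩, by rw [hΦ, hgr]⟩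
  let e := (Φ.ofInjective hΦi).trans (MulEquiv.subgroupCongr hΦr)
  refine ⟨e.symm, fun H => ?_⟩
  obtain ⟨⟨b, c⟩, rfl⟩ := e.surjective H
  rw [e.symm_apply_apply]
  exact hΦs b c

end Reversing

end Subshift

/-! ### Symmetries and reversors of the factor shift -/

section FactorShift

variable {N : ℕ}

theorem period_of_singularPoint (hN : 2 ≤ N) {c : ZMod N} {m : ℤ}
    (h : ∀ n, singularPoint N c (n + m) = singularPoint N c n) : m = 0 := by
  by_contra hm
  have := h m
  rw [← two_mul, singularPoint, if_neg (by omega), singularPoint, if_neg hm, val2_two_mul hm] at this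
  have : Fact (1 < N) := ⟨hN⟩
  simp_all

variable [NeZero N]

/-- The singular points as points of the factor shift. -/
def singularPt (N : ℕ) [NeZero N] (c : ZMod N) : (cyclicPDShift N).Points :=
  ⟨singularPoint N c, singularPoint_mem c⟩

theorem singularPoint_orbit_dense (y : (cyclicPDShift N).Points) (c : ZMod N) (L : ℕ) :
    ∃ m : ℤ, ∀ n : ℤ, |n| ≤ L → singularPoint N c (n + m) = y.1 n := by
  obtain ⟨p, hp, h⟩ := (mem_cyclicPDShift_iff _).1 y.2 L
  refine ⟨p, fun n hn => ?_⟩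
  rw [h n hn, singularPoint, if_neg, add_comm]
  rw [abs_le] at hn
  omega

/-- A symmetry maps the asymptotic pair of singular points with values `0` and `1` to another such
pair, hence agrees with a power of the shift at a singular point, up to the value at the
singularity. That value is pinned down by passing to a limit of translates by `2 ^ k`. -/
theorem eq_zpow_of_mem_symmetryGroup_cyclicPDShift (hN : 2 ≤ N)
    {H : (cyclicPDShift N).Points ≃ₜ (cyclicPDShift N).Points}
    (hH : H ∈ (cyclicPDShift N).symmetryGroup) : ∃ m : ℤ, H = (cyclicPDShift N).shift ^ m := by
  have : Fact (1 < N) := ⟨hN⟩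
  obtain ⟨M, hM⟩ := Subshift.right_asymptotic_apply hH (x := singularPt N 0)
    (x' := singularPt N 1) (M := 1) fun n hn => by
      simp [singularPt, singularPoint, show n ≠ 0 by omega]
  obtain ⟨n₀, hne⟩ : ∃ n, (H (singularPt N 0)).1 n ≠ (H (singularPt N 1)).1 n := by
    by_contra! h
    have := congrFun (congrArg Subtype.val (H.injective (Subtype.ext (funext h)))) 0
    simp [singularPt, singularPoint] at this
  have hS : (cyclicPDShift N).shift ^ n₀ ∈ (cyclicPDShift N).symmetryGroup :=
    Subshift.mem_symmetryGroup_iff.2 ((Commute.refl _).zpow_left n₀)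
  have hF := mul_mem hS hH
  have hx : ((cyclicPDShift N).shift ^ n₀ * H) (singularPt N 0) =
      singularPt N ((H (singularPt N 0)).1 n₀) := by
    refine Subtype.ext (funext fun n => ?_)
    rw [Homeomorph.mul_apply, Subshift.zpow_shift_apply]
    simp only [singularPt, singularPoint]
    split_ifs with h0
    · rw [h0, zero_add]
    · have := eq_val2_of_right_asymptotic hN (H (singularPt N 0)).2 (H (singularPt N 1)).2 hM hne
        (n := n + n₀) (by omega)
      rwa [add_sub_cancel_right] at this
  have hfix : ((cyclicPDShift N).shift ^ n₀ * H) (singularPt N 0) = singularPt N 0 :=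
    Subshift.apply_eq_of_agree hF hx fun L => by
      obtain ⟨k, hk0, hk⟩ := exists_two_pow_gt_natCast_eq (0 : ZMod N) L
      zify at hk
      refine ⟨2 ^ k, fun n hn => ?_⟩
      simp only [singularPt]
      rw [singularPoint_add_two_pow (hn.trans_lt hk), singularPoint_add_two_pow (hn.trans_lt hk),
        hk0]
      exact ⟨rfl, rfl⟩
  have h1 : (cyclicPDShift N).shift ^ n₀ * H = 1 :=
    Subshift.eq_of_apply_eq hF (one_mem _) hfix fun y => singularPoint_orbit_dense y 0
  exact ⟨-n₀, by rw [zpow_neg]; exact eq_inv_of_mul_eq_one_right h1⟩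

/-- The reflection of the factor shift. -/
def reflectPD (N : ℕ) [NeZero N] : (cyclicPDShift N).Points ≃ₜ (cyclicPDShift N).Points where
  toFun y := ⟨fun n => y.1 (-n), reflect_mem_cyclicPDShift y.2⟩
  invFun y := ⟨fun n => y.1 (-n), reflect_mem_cyclicPDShift y.2⟩
  left_inv y := by simp
  right_inv y := by simp
  continuous_toFun := Continuous.subtype_mk (continuous_pi fun _ => Subshift.continuous_eval _) _
  continuous_invFun := Continuous.subtype_mk (continuous_pi fun _ => Subshift.continuous_eval _) _

theorem reflectPD_mul_self : reflectPD N * reflectPD N = 1 :=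
  Homeomorph.ext (reflectPD N).left_inv

theorem reflectPD_mul_zpow (m : ℤ) : reflectPD N * (cyclicPDShift N).shift ^ m =
    (cyclicPDShift N).shift ^ (-m) * reflectPD N := by
  refine Homeomorph.ext fun x => Subtype.ext (funext fun n => ?_)
  rw [Homeomorph.mul_apply, Homeomorph.mul_apply, Subshift.zpow_shift_apply]
  refine (Subshift.zpow_shift_apply m x (-n)).trans ?_
  change _ = x.1 (-(n + -m))
  rw [neg_add, neg_neg]

theorem isReversor_reflectPD : (cyclicPDShift N).IsReversor (reflectPD N) := by
  have := reflectPD_mul_zpow (N := N) 1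
  rw [zpow_one, zpow_neg, zpow_one] at this
  rw [Subshift.IsReversor, this, mul_inv_cancel_right]

theorem zpow_shift_cyclicPDShift_eq_one (hN : 2 ≤ N) {m : ℤ}
    (h : (cyclicPDShift N).shift ^ m = 1) : m = 0 :=
  period_of_singularPoint hN (c := 0) fun n => by
    have := Subshift.zpow_shift_apply m (singularPt N 0) n
    rw [h] at this
    exact this.symm

end FactorShift

/-! ### Symmetries and reversors of the cyclic Thue-Morse shift -/

section ThueMorse

variable {N : ℕ} [NeZero N]

/-- Addition of a constant to all letters, as a symmetry of the cyclic Thue-Morse shift. -/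
def translateTM (N : ℕ) [NeZero N] :
    Multiplicative (ZMod N) →* ((cyclicTMShift N).Points ≃ₜ (cyclicTMShift N).Points) where
  toFun t :=
    { toFun := fun x => ⟨fun n => x.1 n + t.toAdd, add_const_mem_cyclicTMShift x.2 _⟩
      invFun := fun x => ⟨fun n => x.1 n + -t.toAdd, add_const_mem_cyclicTMShift x.2 _⟩
      left_inv := fun x => by simp
      right_inv := fun x => by simp
      continuous_toFun := Continuous.subtype_mk
        (continuous_pi fun n => (Subshift.continuous_eval n).add continuous_const) _
      continuous_invFun := Continuous.subtype_mk
        (continuous_pi fun n => (Subshift.continuous_eval n).add continuous_const) _ }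
  map_one' := Homeomorph.ext fun x => Subtype.ext (funext fun n => add_zero _)
  map_mul' s t := Homeomorph.ext fun x => Subtype.ext (funext fun n => by
    change x.1 n + (s.toAdd + t.toAdd) = x.1 n + t.toAdd + s.toAdd
    ring)

theorem translateTM_apply (t : Multiplicative (ZMod N)) (x : (cyclicTMShift N).Points) (n : ℤ) :
    (translateTM N t x).1 n = x.1 n + t.toAdd := rfl

theorem commute_translateTM_shift (t : Multiplicative (ZMod N)) :
    Commute (translateTM N t) (cyclicTMShift N).shift :=
  Homeomorph.ext fun _ => rfl

/-- The action of `ℤ × C_N` on the cyclic Thue-Morse shift by shifting and by adding constants. -/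
def symmetryTM (N : ℕ) [NeZero N] : Multiplicative ℤ × Multiplicative (ZMod N) →*
    ((cyclicTMShift N).Points ≃ₜ (cyclicTMShift N).Points) :=
  (zpowersHom _ (cyclicTMShift N).shift).noncommCoprod (translateTM N) fun m t => by
    rw [zpowersHom_apply]
    exact ((commute_translateTM_shift t).zpow_right _).symm

theorem symmetryTM_apply (b : Multiplicative ℤ × Multiplicative (ZMod N))
    (x : (cyclicTMShift N).Points) (n : ℤ) :
    (symmetryTM N b x).1 n = x.1 (n + b.1.toAdd) + b.2.toAdd := by
  rw [symmetryTM, MonoidHom.noncommCoprod_apply, zpowersHom_apply, Homeomorph.mul_apply,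
    Subshift.zpow_shift_apply, translateTM_apply]

theorem exists_singular_lift (c a : ZMod N) :
    ∃ x : (cyclicTMShift N).Points, cyclicBlockMap N x.1 = singularPoint N c ∧ x.1 1 = a := by
  obtain ⟨x, hx, ha⟩ := exists_cyclicBlockMap_eq (singularPoint N c) 1 a
  exact ⟨⟨x, (cyclicBlockMap_mem_iff x).1 (hx ▸ singularPoint_mem c)⟩, hx, ha⟩

theorem symmetryTM_injective (hN : 2 ≤ N) : Function.Injective (symmetryTM N) := by
  rw [injective_iff_map_eq_one]
  rintro ⟨m, t⟩ h
  obtain ⟨x, hx, -⟩ := exists_singular_lift (0 : ZMod N) 0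
  have key : ∀ n, x.1 (n + m.toAdd) + t.toAdd = x.1 n := fun n => by
    rw [← symmetryTM_apply (m, t), h]
    rfl
  have hm : m.toAdd = 0 := period_of_singularPoint hN (c := 0) fun n => by
    rw [← hx, cyclicBlockMap, cyclicBlockMap, ← key n, ← key (n + 1), add_right_comm n]
    ring
  have ht : t.toAdd = 0 := by
    have := key 0
    rw [hm] at this
    simpa using this
  exact Prod.ext hm ht

theorem singular_lift_orbit_dense {w : ℤ → ZMod N} {c : ZMod N}
    (hw : cyclicBlockMap N w = singularPoint N c) (x : (cyclicTMShift N).Points) (L : ℕ) :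
    ∃ m : ℤ, ∀ n : ℤ, |n| ≤ L → w (n + m) = x.1 n := by
  obtain ⟨p, hp, h⟩ := (mem_cyclicTMShift_iff _).1 x.2 L
  obtain ⟨M, hM⟩ := exists_digitSum_add_eq (-w 1) (p + L + 1).toNat
  refine ⟨1 + p + M, fun n hn => ?_⟩
  have hn' := abs_le.1 hn
  have e : n + (1 + p + M) = 1 + (((p + n).toNat + M : ℕ) : ℤ) := by omega
  rw [e, eq_add_digitSum hw, hM _ (by omega), h n hn]
  ring

/-- A symmetry `H` maps a right asymptotic pair of preimages of distinct singular points to another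
such pair. Hence, after composition with a power of the shift, `H` maps a preimage of a singular
point to such a preimage; in the limit of translates by `2 ^ k` it becomes the addition of a
constant. -/
theorem range_symmetryTM (hN : 2 ≤ N) :
    (symmetryTM N).range = (cyclicTMShift N).symmetryGroup := by
  have : Fact (1 < N) := ⟨hN⟩
  have hsub : ∀ b, symmetryTM N b ∈ (cyclicTMShift N).symmetryGroup := fun b => by
    rw [Subshift.mem_symmetryGroup_iff, symmetryTM, MonoidHom.noncommCoprod_apply,
      zpowersHom_apply]
    exact ((Commute.refl _).zpow_left _).mul_left (commute_translateTM_shift _)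
  refine le_antisymm (by rintro _ ⟨b, rfl⟩; exact hsub b) fun H hH => ?_
  obtain ⟨x₀, hx₀, hx₀1⟩ := exists_singular_lift (0 : ZMod N) 0
  obtain ⟨x₁, hx₁, hx₁1⟩ := exists_singular_lift (1 : ZMod N) 0
  obtain ⟨M, hM⟩ := Subshift.right_asymptotic_apply hH (x := x₀) (x' := x₁) (M := 1)
    fun n hn => by
      obtain ⟨m, rfl⟩ : ∃ m : ℕ, n = 1 + m := ⟨(n - 1).toNat, by omega⟩
      rw [eq_add_digitSum hx₀, eq_add_digitSum hx₁, hx₀1, hx₁1]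
  obtain ⟨n₀, hne⟩ : ∃ n, cyclicBlockMap N (H x₀).1 n ≠ cyclicBlockMap N (H x₁).1 n := by
    by_contra! h
    have heq : H x₀ = H x₁ := Subtype.ext (funext fun n =>
      eq_of_cyclicBlockMap_eq (a := min M n) (b := max M n) (k := M) (fun m _ _ => h m)
        (by simp) (by simp) (hM M le_rfl) (by simp) (by simp))
    have h01 := congrFun (hx₀.symm.trans ((congrArg (fun x => cyclicBlockMap N x.1)
      (H.injective heq)).trans hx₁)) 0
    simp [singularPoint] at h01
  have hF := mul_mem (hsub (Multiplicative.ofAdd n₀, 1)) hH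
  set F := symmetryTM N (Multiplicative.ofAdd n₀, 1) * H with hFdef
  have hFx : ∀ n, (F x₀).1 n = (H x₀).1 (n + n₀) := fun n => by
    rw [hFdef, Homeomorph.mul_apply, symmetryTM_apply]
    simp
  have hx : cyclicBlockMap N (F x₀).1 = singularPoint N (cyclicBlockMap N (H x₀).1 n₀) := by
    funext n
    have e : cyclicBlockMap N (F x₀).1 n = cyclicBlockMap N (H x₀).1 (n + n₀) := by
      rw [cyclicBlockMap, cyclicBlockMap, hFx, hFx, add_right_comm]
    rw [e, singularPoint]
    split_ifs with h0
    · rw [h0, zero_add]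
    · have := eq_val2_of_right_asymptotic hN ((cyclicBlockMap_mem_iff _).2 (H x₀).2)
        ((cyclicBlockMap_mem_iff _).2 (H x₁).2) (M := M)
        (fun n hn => by rw [cyclicBlockMap, cyclicBlockMap, hM n hn, hM (n + 1) (by omega)]) hne
        (n := n + n₀) (by omega)
      rwa [add_sub_cancel_right] at this
  obtain ⟨w, hw, hw1⟩ := exists_singular_lift (0 : ZMod N) 1
  set b : Multiplicative ℤ × Multiplicative (ZMod N) := (1, Multiplicative.ofAdd ((F x₀).1 1))
  have hb : ∀ n, (symmetryTM N b w).1 n = w.1 n + (F x₀).1 1 := fun n => by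
    rw [symmetryTM_apply]; simp [b]
  have hfix : F w = symmetryTM N b w := Subshift.apply_eq_of_agree hF rfl fun L => by
    obtain ⟨k, hk0, hk⟩ := exists_two_pow_gt_natCast_eq (0 : ZMod N) L
    zify at hk
    refine ⟨2 ^ k, fun n hn => ⟨?_, ?_⟩⟩
    · exact apply_add_two_pow_of_singular hx₀ (by rw [hw, hk0]) (by rw [hw1, hx₀1, zero_add])
        (hn.trans_lt hk)
    · refine apply_add_two_pow_of_singular hx ?_ ?_ (hn.trans_lt hk)
      · rw [hk0, ← hw, ← cyclicBlockMap_add_const w.1 ((F x₀).1 1)]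
        exact congrArg _ (funext hb)
      · rw [hb, hw1, add_comm]
  have hFb : F = symmetryTM N b :=
    Subshift.eq_of_apply_eq hF (hsub b) hfix (singular_lift_orbit_dense hw)
  refine ⟨(Multiplicative.ofAdd n₀, 1)⁻¹ * b, ?_⟩
  rw [map_mul, ← hFb, map_inv, hFdef, inv_mul_cancel_left]

/-- The reflection combined with negation of all letters. -/
def negReflectTM (N : ℕ) [NeZero N] : (cyclicTMShift N).Points ≃ₜ (cyclicTMShift N).Points where
  toFun x := ⟨fun n => -x.1 (-n), neg_reflect_mem_cyclicTMShift x.2⟩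
  invFun x := ⟨fun n => -x.1 (-n), neg_reflect_mem_cyclicTMShift x.2⟩
  left_inv x := by simp
  right_inv x := by simp
  continuous_toFun := Continuous.subtype_mk (continuous_pi fun _ => (Subshift.continuous_eval _).neg) _
  continuous_invFun := Continuous.subtype_mk (continuous_pi fun _ => (Subshift.continuous_eval _).neg) _

theorem negReflectTM_mul_self : negReflectTM N * negReflectTM N = 1 :=
  Homeomorph.ext (negReflectTM N).left_inv

theorem negReflectTM_mul_symmetryTM (b : Multiplicative ℤ × Multiplicative (ZMod N)) :
    negReflectTM N * symmetryTM N b = symmetryTM N b⁻¹ * negReflectTM N := by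
  refine Homeomorph.ext fun x => Subtype.ext (funext fun n => ?_)
  rw [Homeomorph.mul_apply, Homeomorph.mul_apply, symmetryTM_apply]
  refine (congrArg Neg.neg (symmetryTM_apply b x (-n))).trans ?_
  change _ = -x.1 (-(n + -b.1.toAdd)) + -b.2.toAdd
  rw [neg_add, neg_add, neg_neg]

theorem symmetryTM_ofAdd_one :
    symmetryTM N (Multiplicative.ofAdd 1, 1) = (cyclicTMShift N).shift := by
  simp [symmetryTM]

theorem isReversor_negReflectTM : (cyclicTMShift N).IsReversor (negReflectTM N) := by
  have := negReflectTM_mul_symmetryTM (N := N) (Multiplicative.ofAdd 1, 1)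
  rw [map_inv, symmetryTM_ofAdd_one] at this
  rw [Subshift.IsReversor, this, mul_inv_cancel_right]

/-- Since `-x (-n)` always belongs to the shift, reflection invariance means invariance under
negation, which corresponds to `y ↦ 2 - y` in the factor shift. As `y` vanishes on one coset of
`2ℤ` and equals `1` on a coset of `4ℤ`, this forces `2 = 0` in `ZMod N`. -/
theorem isReflectionInvariant_cyclicTMShift_iff (hN : 2 ≤ N) :
    (cyclicTMShift N).IsReflectionInvariant ↔ N = 2 := by
  have : Fact (1 < N) := ⟨hN⟩
  constructor
  · intro h
    obtain ⟨x, hx, -⟩ := exists_singular_lift (0 : ZMod N) 0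
    have h1 : (fun n => -x.1 n) ∈ (cyclicTMShift N).carrier :=
      Set.Subset.antisymm_iff.1 h |>.1 ⟨_, neg_reflect_mem_cyclicTMShift x.2, by simp⟩
    have h2 : ∀ n, n ≠ 0 → cyclicBlockMap N (fun n => -x.1 n) n = 2 - val2 N n := fun n hn => by
      have := congrFun hx n
      rw [singularPoint, if_neg hn] at this
      rw [← this, cyclicBlockMap, cyclicBlockMap]
      ring
    obtain ⟨p, -, hp⟩ := (mem_cyclicPDShift_iff _).1 ((cyclicBlockMap_mem_iff _).2 h1) 2
    rcases Int.even_or_odd p with he | ho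
    · have := hp 1 (by norm_num)
      rw [h2 1 one_ne_zero, val2_odd odd_one, val2_odd (he.add_odd odd_one), sub_zero] at this
      have h3 : ((2 : ℕ) : ZMod N) = 0 := by exact_mod_cast this
      rw [ZMod.natCast_eq_zero_iff] at h3
      exact le_antisymm (Nat.le_of_dvd two_pos h3) hN
    · have := hp 2 (by norm_num)
      have h3 := val2_two_pow (N := N) 1
      rw [pow_one] at h3
      rw [h2 2 two_ne_zero, val2_odd (ho.add_even even_two), h3] at this
      norm_num at this
  · rintro rfl
    have hneg : ∀ x ∈ (cyclicTMShift 2).carrier, (fun n => x (-n)) ∈ (cyclicTMShift 2).carrier := by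
      intro x hx
      simpa only [ZMod.neg_eq_self_mod_two] using neg_reflect_mem_cyclicTMShift hx
    refine Set.Subset.antisymm ?_ fun x hx => ⟨_, hneg x hx, by simp⟩
    rintro _ ⟨x, hx, rfl⟩
    exact hneg x hx

end ThueMorse

theorem mainTheorem3 (N : ℕ) (hN : 2 ≤ N) :
    -- the factor shift `X'_N`
    ((cyclicPDShift N).symmetryGroup = Subgroup.zpowers (cyclicPDShift N).shift ∧
      Nonempty ((cyclicPDShift N).symmetryGroup ≃* Multiplicative ℤ) ∧
      (cyclicPDShift N).IsReversible ∧
      (∃ e : (cyclicPDShift N).reversingGroup ≃*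
          Multiplicative ℤ ⋊[inversionAction (Multiplicative ℤ)] Multiplicative (ZMod 2),
        ∀ H : (cyclicPDShift N).reversingGroup,
          (H : (cyclicPDShift N).Points ≃ₜ (cyclicPDShift N).Points) ∈
            (cyclicPDShift N).symmetryGroup ↔ (e H).right = 1) ∧
      (∀ H, (cyclicPDShift N).IsReversor H → orderOf H = 2)) ∧
    -- the cyclic Thue--Morse shift `X_N`
    (Subshift.IsGlobalCover N (cyclicBlockMap N) (cyclicTMShift N)
        (cyclicPDShift N) ∧
      Nonempty ((cyclicTMShift N).symmetryGroup ≃*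
        Multiplicative ℤ × Multiplicative (ZMod N)) ∧
      ((cyclicTMShift N).IsReflectionInvariant ↔ N = 2) ∧
      (∃ H, (cyclicTMShift N).IsReversor H ∧ orderOf H = 2) ∧
      (∃ e : (cyclicTMShift N).reversingGroup ≃*
          (Multiplicative ℤ × Multiplicative (ZMod N))
            ⋊[inversionAction (Multiplicative ℤ × Multiplicative (ZMod N))]
            Multiplicative (ZMod 2),
        ∀ H : (cyclicTMShift N).reversingGroup,
          (H : (cyclicTMShift N).Points ≃ₜ (cyclicTMShift N).Points) ∈
            (cyclicTMShift N).symmetryGroup ↔ (e H).right = 1) ∧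
      (∀ H, (cyclicTMShift N).IsReversor H → orderOf H = 2)) := by
  have : NeZero N := ⟨by omega⟩
  have hf : (zpowersHom _ (cyclicPDShift N).shift).range = (cyclicPDShift N).symmetryGroup := by
    ext H
    constructor
    · rintro ⟨m, rfl⟩
      rw [Subshift.mem_symmetryGroup_iff, zpowersHom_apply]
      exact (Commute.refl _).zpow_left _
    · intro hH
      obtain ⟨m, rfl⟩ := eq_zpow_of_mem_symmetryGroup_cyclicPDShift hN hH
      exact ⟨Multiplicative.ofAdd m, rfl⟩
  have hinj : Function.Injective (zpowersHom _ (cyclicPDShift N).shift) :=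
    (injective_iff_map_eq_one _).2 fun m hm => zpow_shift_cyclicPDShift_eq_one hN hm
  have hs : (cyclicPDShift N).shift * (cyclicPDShift N).shift ≠ 1 := fun h =>
    two_ne_zero (zpow_shift_cyclicPDShift_eq_one hN (m := 2) (by rw [zpow_two, h]))
  have hinv : ∀ m : Multiplicative ℤ, reflectPD N * zpowersHom _ (cyclicPDShift N).shift m =
      zpowersHom _ (cyclicPDShift N).shift m⁻¹ * reflectPD N := fun m =>
    reflectPD_mul_zpow m.toAdd
  have hs' : (cyclicTMShift N).shift * (cyclicTMShift N).shift ≠ 1 := fun h => by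
    rw [← symmetryTM_ofAdd_one, ← map_mul] at h
    have := congrArg (fun b => b.1.toAdd) (symmetryTM_injective hN (h.trans (map_one _).symm))
    simp at this
  refine ⟨⟨hf.symm, ⟨((MonoidHom.ofInjective hinj).trans (MulEquiv.subgroupCongr hf)).symm⟩,
    ⟨_, isReversor_reflectPD⟩,
    Subshift.exists_reversingGroup_equiv hs hinj hf isReversor_reflectPD reflectPD_mul_self hinv,
    fun H hH => isReversor_reflectPD.orderOf_eq_two hs hf reflectPD_mul_self hinv hH⟩,
    isGlobalCover_cyclicBlockMap,
    ⟨((MonoidHom.ofInjective (symmetryTM_injective hN)).trans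
      (MulEquiv.subgroupCongr (range_symmetryTM hN))).symm⟩,
    isReflectionInvariant_cyclicTMShift_iff hN, ?_,
    Subshift.exists_reversingGroup_equiv hs' (symmetryTM_injective hN) (range_symmetryTM hN)
      isReversor_negReflectTM negReflectTM_mul_self negReflectTM_mul_symmetryTM, ?_⟩
  · exact ⟨_, isReversor_negReflectTM, isReversor_negReflectTM.orderOf_eq_two hs'
      (range_symmetryTM hN) negReflectTM_mul_self negReflectTM_mul_symmetryTM
      isReversor_negReflectTM⟩
  · exact fun H hH => isReversor_negReflectTM.orderOf_eq_two hs' (range_symmetryTM hN)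
      negReflectTM_mul_self negReflectTM_mul_symmetryTM hH
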